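/- Let $S=(S_t)_{t\ge 0}$ be a simple symmetric random walk on $\mathbb Z$ started at $0$. For $r=(r_x)_{x\in\mathbb Z}\in[0,1]^{\mathbb Z}$ let $\xi=(\xi_{t,x})_{t\ge 0,\,x\in\mathbb Z}$ be random variables with values in $\{0,1\}$ and $\mathbb P(\xi_{t,x}=0)=r_x=1-\mathbb P(\xi_{t,x}=1)$, independent of each other and of $S$ ($0$ stands for tails, $1$ for heads). Put $\tau(r)=\inf\{t\ge 0:\ \xi_{t,S_t}=0\}$, with $\inf\emptyset=\infty$, and let $\mathcal F^{S,\xi}_t=\sigma(S_u,\xi_{u,S_u}:\ u\le t)$. **Theorem.** For every probability measure $\mu$ on $\mathbb Z$ with finite first moment and mean zero there is a vector $r_\mu\in[0,1]^{\mathbb Z}$, depending only on $\mu$, with the following properties. 1. For every choice of the probability space, of $S$ and of $\xi$ as above with $r=r_\mu$, the time $\tau=\tau(r_\mu)$ is an $(\mathcal F^{S,\xi}_t)$-stopping time, it is almost surely finite, $S_{\tau}$ has law $\mu$, and the stopped process $(S_{t\wedge\tau})_{t\ge 0}$ is uniformly integrable. 2. If $\mu$ has finite support, with smallest point $A$ and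 largest point $B$, then $r_\mu$ is the greatest element, in the coordinatewise order, of the set $$\mathcal R_\mu=\bigl\{r\in[0,1]^{\mathbb Z}:\ r_i=1 \text{ for } i\notin(A,B),\ \ \mathbb P\bigl(\tau(r)<\infty,\ S_{\tau(r)}=i\bigr)\le\mu(\{i\}) \text{ for } i\in\mathbb Z\cap(A,B)\bigr\}.$$ -/

import Mathlib

open MeasureTheory ProbabilityTheory unitInterval
open scoped ENNReal

noncomputable section

namespace RandomizedEmbedding

/-- `μ` has a finite first moment and is centered. -/
structure IsCentered (μ : Measure ℤ) : Prop where
  integrable : Integrable (fun x : ℤ => (x : ℝ)) μ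
  mean_zero : ∫ x : ℤ, (x : ℝ) ∂μ = 0

/-- The probability `1/2` as an element of the unit interval. -/
def half : I := ⟨1 / 2, by norm_num, by norm_num⟩

variable {Ω : Type*} [mΩ : MeasurableSpace Ω]

/-- `S` is a simple symmetric random walk on `ℤ` started at `0`: its increments are independent
and take the values `1` and `-1` with probability `1/2` each. -/
structure IsSimpleRandomWalk (P : Measure Ω) (S : ℕ → Ω → ℤ) : Prop where
  measurable : ∀ t, Measurable (S t)
  start : ∀ᵐ ω ∂P, S 0 ω = 0
  indep : iIndepFun (fun t ω => S (t + 1) ω - S t ω) P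
  law : ∀ t, HasLaw (fun ω => S (t + 1) ω - S t ω) (bernoulliMeasure (1 : ℤ) (-1) half) P

/-- `ξ t x` is the outcome of the coin tossed at time `t` in state `x`, where `1` stands for heads
and `0` for tails: the coin shows tails with probability `r x`, and the coins are independent of
each other and of the process `S`. -/
structure IsCoinFamily (P : Measure Ω) (S : ℕ → Ω → ℤ) (r : ℤ → I) (ξ : ℕ → ℤ → Ω → Fin 2) :
    Prop where
  measurable : ∀ t x, Measurable (ξ t x)
  law : ∀ t x, HasLaw (ξ t x) (bernoulliMeasure (0 : Fin 2) 1 (r x)) P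
  indep : iIndepFun (fun (p : ℕ × ℤ) => ξ p.1 p.2) P
  indep_walk : IndepFun (fun ω (t : ℕ) => S t ω) (fun ω (p : ℕ × ℤ) => ξ p.1 p.2 ω) P

/-- The randomized Markovian stopping time `inf {t ≥ 0 | ξ_{t, S_t} = 0}`, with `inf ∅ = ⊤`. -/
def coinTime (S : ℕ → Ω → ℤ) (ξ : ℕ → ℤ → Ω → Fin 2) : Ω → WithTop ℕ :=
  hittingAfter (fun t ω => ξ t (S t ω) ω) {0} 0

theorem measurable_coin {S : ℕ → Ω → ℤ} {ξ : ℕ → ℤ → Ω → Fin 2} (hS : ∀ t, Measurable (S t))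
    (hξ : ∀ t x, Measurable (ξ t x)) (t : ℕ) : Measurable (fun ω => ξ t (S t ω) ω) :=
  (measurable_from_prod_countable_right (f := fun p : ℤ × Ω => ξ t p.1 p.2) (hξ t)).comp
    ((hS t).prodMk measurable_id)

/-- The filtration `σ(S_u, ξ_{u, S_u}, u ≤ t)`. -/
def coinFiltration (S : ℕ → Ω → ℤ) (ξ : ℕ → ℤ → Ω → Fin 2) (hS : ∀ t, Measurable (S t))
    (hξ : ∀ t x, Measurable (ξ t x)) : Filtration ℕ mΩ where
  seq t := ⨆ u ≤ t, MeasurableSpace.comap (S u) inferInstance ⊔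
    MeasurableSpace.comap (fun ω => ξ u (S u ω) ω) inferInstance
  mono' _ _ hst := iSup₂_mono' fun u hu => ⟨u, hu.trans hst, le_rfl⟩
  le' _ := iSup₂_le fun u _ => sup_le (hS u).comap_le (measurable_coin hS hξ u).comap_le

/-- `τ` solves the Skorokhod embedding problem for `μ` and the process `S` relative to the
filtration `𝓕`: it is an almost surely finite `𝓕`-stopping time, `S_τ` has law `μ`, and the stopped
process `(S_{t ∧ τ})` is uniformly integrable. -/
structure SolvesSEP (𝓕 : Filtration ℕ mΩ) (P : Measure Ω) (S : ℕ → Ω → ℤ) (μ : Measure ℤ)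
    (τ : Ω → WithTop ℕ) : Prop where
  isStoppingTime : IsStoppingTime 𝓕 τ
  finite : ∀ᵐ ω ∂P, τ ω ≠ ⊤
  law : HasLaw (stoppedValue S τ) μ P
  uniformIntegrable : UniformIntegrable (stoppedProcess (fun t ω => (S t ω : ℝ)) τ) 1 P

/-- A concrete sample space carrying the increments of the walk and all the coins. -/
abbrev CoinSpace : Type := (ℕ → ℤ) × (ℕ × ℤ → Fin 2)

/-- Independent fair `±1` increments, and independent coins with tails probabilities `r`. -/
def coinMeasure (r : ℤ → I) : Measure CoinSpace :=
  (Measure.infinitePi fun _ : ℕ => bernoulliMeasure (1 : ℤ) (-1) half).prod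
    (Measure.infinitePi fun p : ℕ × ℤ => bernoulliMeasure (0 : Fin 2) 1 (r p.2))

/-- The walk on the concrete sample space. -/
def coinWalk (t : ℕ) (ω : CoinSpace) : ℤ := ∑ u ∈ Finset.range t, ω.1 u

/-- The coins on the concrete sample space. -/
def coin (t : ℕ) (x : ℤ) (ω : CoinSpace) : Fin 2 := ω.2 (t, x)

instance (r : ℤ → I) : IsProbabilityMeasure (coinMeasure r) := by
  unfold coinMeasure; infer_instance

theorem hasLaw_fst (r : ℤ → I) (t : ℕ) :
    HasLaw (fun ω : CoinSpace => ω.1 t) (bernoulliMeasure (1 : ℤ) (-1) half) (coinMeasure r) :=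
  ((measurePreserving_eval_infinitePi
    (fun _ : ℕ => bernoulliMeasure (1 : ℤ) (-1) half) t).comp measurePreserving_fst).hasLaw

theorem hasLaw_snd (r : ℤ → I) (p : ℕ × ℤ) :
    HasLaw (fun ω : CoinSpace => ω.2 p) (bernoulliMeasure (0 : Fin 2) 1 (r p.2))
      (coinMeasure r) :=
  ((measurePreserving_eval_infinitePi
    (fun p : ℕ × ℤ => bernoulliMeasure (0 : Fin 2) 1 (r p.2)) p).comp measurePreserving_snd).hasLaw

theorem isSimpleRandomWalk_coinWalk (r : ℤ → I) :
    IsSimpleRandomWalk (coinMeasure r) coinWalk where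
  measurable t := by unfold coinWalk; fun_prop
  start := by simp [coinWalk]
  indep := by
    simp only [coinWalk, Finset.sum_range_succ, add_sub_cancel_left]
    rw [iIndepFun_iff_map_fun_eq_infinitePi_map (by fun_prop)]
    simp only [(hasLaw_fst r _).map_eq]
    exact measurePreserving_fst.map_eq
  law t := by
    simp only [coinWalk, Finset.sum_range_succ, add_sub_cancel_left]
    exact hasLaw_fst r t

theorem isCoinFamily_coin (r : ℤ → I) : IsCoinFamily (coinMeasure r) coinWalk r coin where
  measurable t x := by unfold coin; fun_prop
  law t x := hasLaw_snd r (t, x)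
  indep := by
    change iIndepFun (fun (p : ℕ × ℤ) (ω : CoinSpace) => ω.2 p) (coinMeasure r)
    rw [iIndepFun_iff_map_fun_eq_infinitePi_map (by fun_prop)]
    simp only [(hasLaw_snd r _).map_eq]
    exact measurePreserving_snd.map_eq
  indep_walk := by
    exact indepFun_prod (X := fun (x : ℕ → ℤ) (t : ℕ) => ∑ u ∈ Finset.range t, x u)
      (Y := fun y : ℕ × ℤ → Fin 2 => y) (by fun_prop) (by fun_prop)

/-- The probability that the walk, stopped according to the stopping probabilities `r`, is stopped
(in finite time) in the state `i`. -/
def stopProb (r : ℤ → I) (i : ℤ) : ℝ≥0∞ :=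
  coinMeasure r {ω | coinTime coinWalk coin ω ≠ ⊤ ∧
    stoppedValue coinWalk (coinTime coinWalk coin) ω = i}

/-- The vectors of stopping probabilities that stop surely outside the open interval `(A, B)` and
embed in each state of `(A, B)` at most the mass prescribed by `μ`. -/
def subEmbeddings (μ : Measure ℤ) (A B : ℤ) : Set (ℤ → I) :=
  {r | (∀ i ∉ Set.Ioo A B, r i = 1) ∧ ∀ i ∈ Set.Ioo A B, stopProb r i ≤ μ {i}}

end RandomizedEmbedding

end

/-! The stopping probabilities are explicit. Let `U(x) = ∫ |x - y| dμ(y) - |x|` be the potential of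
`μ`. It is nonnegative because `μ` is centered, it tends to `0` at `±∞`, and half its second
difference is `μ - δ₀` (`potential_eq`). The stopping probability is `μ{x} / (μ{x} + U(x))`.

Stopping with probabilities `r` has the Green function `G`, the expected number of visits before or
at the stopping time. It is the least nonnegative solution of
`G(x) = δ₀(x) + ((1 - r) G)(x - 1) / 2 + ((1 - r) G)(x + 1) / 2`, and the mass stopped in `x` is
`r(x) G(x)` (`measure_stoppedValue_eq`, by Fubini over the coins and the Markov recursion of the
walk). For the explicit `r`, the function `μ + U` solves this equation, so `G ≤ μ + U`. The
difference `w` satisfies `w(x) = ((1 - r) w)(x - 1) / 2 + ((1 - r) w)(x + 1) / 2`, so `(1 - r) w` is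
convex, and it lies between `0` and `U`, hence vanishes; therefore `G = μ + U`
(`toReal_green_embeddingRate`) and the stopped mass is `r G = μ`. Its total is `1`, so that the
stopping time is almost surely finite.

Uniform integrability follows from convergence in `L¹`. By the discrete Tanaka formula
(`moment_balance`), `E|S_{t ∧ τ}|` is the expected number of departures from `0` before `t` and `τ`,
which is at most `(1 - r(0)) G(0) = U(0) = ∫ |y| dμ(y)`. The part of the walk that is already
stopped exhausts this bound, so the part that is still alive vanishes in `L¹`.

If `r` is any competitor for a finitely supported `μ` and `G` is its Green function, then
`(1 - r) G - U` vanishes outside `(A, B)` and is concave inside, so it is nonnegative. Hence in each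
state of `(A, B)` at most the mass `μ` is stopped and at least the mass `U` survives the coin, which
gives `r ≤ μ / (μ + U)` (`le_embeddingRate`). -/

noncomputable section

namespace RandomizedEmbedding

open Filter Topology Set

/-! ### The Green function of the stopped walk -/

/-- The probability of tails (stopping) in state `x`, as an extended nonnegative real. -/
def tails (r : ℤ → I) (x : ℤ) : ℝ≥0∞ := (toNNReal (r x) : ℝ≥0∞)

/-- The probability of heads (continuing) in state `x`, as an extended nonnegative real. -/
def heads (r : ℤ → I) (x : ℤ) : ℝ≥0∞ := (toNNReal (σ (r x)) : ℝ≥0∞)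

theorem tails_add_heads (r : ℤ → I) (x : ℤ) : tails r x + heads r x = 1 := by
  unfold tails heads
  rw [← ENNReal.coe_add]
  norm_cast
  ext
  simp

theorem heads_le_one (r : ℤ → I) (x : ℤ) : heads r x ≤ 1 :=
  (tails_add_heads r x).le.trans' le_add_self

theorem heads_ne_top (r : ℤ → I) (x : ℤ) : heads r x ≠ ⊤ := ENNReal.coe_ne_top

theorem tails_ne_top (r : ℤ → I) (x : ℤ) : tails r x ≠ ⊤ := ENNReal.coe_ne_top

theorem toReal_tails (r : ℤ → I) (x : ℤ) : (tails r x).toReal = r x := by simp [tails]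

theorem toReal_heads (r : ℤ → I) (x : ℤ) : (heads r x).toReal = 1 - r x := by simp [heads]

/-- The mass function at time `t` of the walk that has not been stopped before time `t`, defined
by the one-step recursion; the coin at time `t` has not been tossed yet. -/
def aliveMass (r : ℤ → I) : ℕ → ℤ → ℝ≥0∞
  | 0, x => if x = 0 then 1 else 0
  | t + 1, x =>
    (heads r (x - 1) * aliveMass r t (x - 1) + heads r (x + 1) * aliveMass r t (x + 1)) / 2

/-- The expected number of times at which the walk, not stopped earlier, is in state `x`. -/
def green (r : ℤ → I) (x : ℤ) : ℝ≥0∞ := ∑' t, aliveMass r t x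

theorem green_eq (r : ℤ → I) (x : ℤ) :
    green r x = (if x = 0 then 1 else 0) +
      (heads r (x - 1) * green r (x - 1) + heads r (x + 1) * green r (x + 1)) / 2 := by
  unfold green
  rw [tsum_eq_zero_add' ENNReal.summable]
  simp only [aliveMass, ← ENNReal.tsum_mul_left, div_eq_mul_inv]
  rw [← ENNReal.tsum_add, ← ENNReal.tsum_mul_right]

/-- The Green function is the least nonnegative supersolution of its equation. -/
theorem green_le_of_supersolution (r : ℤ → I) (H : ℤ → ℝ≥0∞)
    (hH : ∀ x, (if x = 0 then 1 else 0) +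
      (heads r (x - 1) * H (x - 1) + heads r (x + 1) * H (x + 1)) / 2 ≤ H x) (x : ℤ) :
    green r x ≤ H x := by
  unfold green
  rw [ENNReal.tsum_eq_iSup_nat]
  refine iSup_le fun n => ?_
  induction n generalizing x with
  | zero => simp
  | succ n ih =>
    rw [Finset.sum_range_succ']
    simp only [aliveMass, div_eq_mul_inv]
    rw [← Finset.sum_mul, Finset.sum_add_distrib, ← Finset.mul_sum, ← Finset.mul_sum, add_comm]
    refine le_trans ?_ (hH x)
    rw [div_eq_mul_inv]
    gcongr
    · exact ih _
    · exact ih _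

/-- The real form of the Green function equation: half the second difference of `(1 - r) G` is
`r G - δ₀`. -/
theorem toReal_green_eq {r : ℤ → I} (hG : ∀ x, green r x ≠ ⊤) (x : ℤ) :
    (green r x).toReal = (if x = 0 then 1 else 0) +
      ((1 - r (x - 1)) * (green r (x - 1)).toReal +
        (1 - r (x + 1)) * (green r (x + 1)).toReal) / 2 := by
  have hf (y : ℤ) : heads r y * green r y ≠ ⊤ :=
    ENNReal.mul_ne_top (heads_ne_top r y) (hG y)
  conv_lhs => rw [green_eq]
  rw [ENNReal.toReal_add (by split_ifs <;> simp) (ENNReal.div_ne_top (by simp [hf]) (by simp)),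
    ENNReal.toReal_div, ENNReal.toReal_add (hf _) (hf _), ENNReal.toReal_mul, ENNReal.toReal_mul,
    toReal_heads, toReal_heads]
  congr 1
  split_ifs <;> simp

/-- Stopping outside a bounded interval makes the Green function finite, by comparison with the
tent function `x ↦ (C - |x|)⁺`. -/
theorem green_ne_top_of_bounded {r : ℤ → I} {A B : ℤ} (hr : ∀ i ∉ Ioo A B, r i = 1) (x : ℤ) :
    green r x ≠ ⊤ := by
  set C : ℕ := max A.natAbs B.natAbs + 1 with hC
  refine ne_top_of_le_ne_top (b := ((C - x.natAbs : ℕ) : ℝ≥0∞)) (ENNReal.natCast_ne_top _)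
    (green_le_of_supersolution r (fun x => ((C - x.natAbs : ℕ) : ℝ≥0∞)) (fun x => ?_) x)
  have hh (y : ℤ) (hy : C ≤ y.natAbs + 1) : heads r y = 0 := by
    have : r y = 1 := hr y (by simp only [mem_Ioo]; omega)
    simp [heads, this]
  by_cases hx : C ≤ x.natAbs
  · have h0 : x ≠ 0 := by rintro rfl; simp at hx
    simp [h0, hh (x - 1) (by omega), hh (x + 1) (by omega)]
  · calc _ ≤ (if x = 0 then 1 else 0) + ((1 : ℝ≥0∞) * ((C - (x - 1).natAbs : ℕ) : ℝ≥0∞) +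
          1 * ((C - (x + 1).natAbs : ℕ) : ℝ≥0∞)) / 2 := by
          gcongr <;> exact heads_le_one _ _
      _ = ((C - x.natAbs : ℕ) : ℝ≥0∞) := by
          have : ((if x = 0 then 1 else 0) * 2 + ((C - (x - 1).natAbs : ℕ) +
              (C - (x + 1).natAbs : ℕ)) : ℕ) = (C - x.natAbs : ℕ) * 2 := by
            split_ifs <;> omega
          have h2 : (2 : ℝ≥0∞) ≠ 0 := by simp
          rw [← ENNReal.mul_div_cancel_right (a := ((C - x.natAbs : ℕ) : ℝ≥0∞)) h2 (by simp),
            ← Nat.cast_two, ← Nat.cast_mul, ← this]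
          push_cast
          rw [one_mul, one_mul, ENNReal.add_div (a := _ * 2),
            ENNReal.mul_div_cancel_right h2 (by simp)]

/-- A form of the maximum principle on `ℤ`: a function that is midpoint convex where it is positive
and that vanishes at infinity is nowhere positive. -/
theorem nonpos_of_subharmonic {u : ℤ → ℝ} (htop : Tendsto u atTop (𝓝 0))
    (hbot : Tendsto u atBot (𝓝 0)) (hu : ∀ x, 0 < u x → 2 * u x ≤ u (x - 1) + u (x + 1)) (x : ℤ) :
    u x ≤ 0 := by
  -- The positive part is midpoint convex everywhere, so that its increments are monotone; they
  -- vanish at both ends, hence everywhere.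
  set v : ℤ → ℝ := fun x => max (u x) 0 with hv
  have hvtop : Tendsto v atTop (𝓝 0) := by simpa using htop.max (tendsto_const_nhds (x := 0))
  have hvbot : Tendsto v atBot (𝓝 0) := by simpa using hbot.max (tendsto_const_nhds (x := 0))
  have hconv (x : ℤ) : 2 * v x ≤ v (x - 1) + v (x + 1) := by
    rcases le_or_gt (u x) 0 with h | h
    · have : v x = 0 := max_eq_right h
      rw [this, mul_zero]
      exact add_nonneg (le_max_right _ _) (le_max_right _ _)
    · have : v x = u x := max_eq_left h.le
      rw [this]
      exact (hu x h).trans (add_le_add (le_max_left _ _) (le_max_left _ _))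
  have hmono : Monotone fun x => v (x + 1) - v x := by
    refine monotone_int_of_le_succ fun x => ?_
    have := hconv (x + 1)
    rw [add_sub_cancel_right] at this
    linarith
  have hdtop : Tendsto (fun x => v (x + 1) - v x) atTop (𝓝 0) := by
    simpa using (hvtop.comp (tendsto_atTop_add_const_right _ 1 tendsto_id)).sub hvtop
  have hdbot : Tendsto (fun x => v (x + 1) - v x) atBot (𝓝 0) := by
    simpa using (hvbot.comp (tendsto_atBot_add_const_right _ 1 tendsto_id)).sub hvbot
  have hd (x : ℤ) : v (x + 1) = v x := by
    have h1 := hmono.ge_of_tendsto hdtop x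
    have h2 := hmono.le_of_tendsto hdbot x
    linarith
  have hmon : Monotone v := monotone_int_of_le_succ fun x => (hd x).ge
  exact (le_max_left _ _).trans (hmon.ge_of_tendsto hvtop x)

/-- The balance of the first absolute moment: between times `0` and `t` the expected increase of
the absolute value of the stopped walk is the expected number of departures from `0`. The reason is
that a step of the walk increases the absolute value by `0` on average, and by `1` from `0`. -/
theorem moment_balance (r : ℤ → I) (t : ℕ) :
    ∑' x : ℤ, (x.natAbs : ℝ≥0∞) * aliveMass r t x +
      ∑ s ∈ Finset.range t, ∑' x : ℤ, (x.natAbs : ℝ≥0∞) * (tails r x * aliveMass r s x) =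
      ∑ s ∈ Finset.range t, heads r 0 * aliveMass r s 0 := by
  induction t with
  | zero =>
    simp only [Finset.range_zero, Finset.sum_empty, add_zero, ENNReal.tsum_eq_zero]
    intro x
    by_cases hx : x = 0 <;> simp [aliveMass, hx]
  | succ t ih =>
    have key : ∑' x : ℤ, (x.natAbs : ℝ≥0∞) * aliveMass r (t + 1) x =
        ∑' x : ℤ, (x.natAbs : ℝ≥0∞) * (heads r x * aliveMass r t x) +
          heads r 0 * aliveMass r t 0 := by
      set f : ℤ → ℝ≥0∞ := fun x => heads r x * aliveMass r t x with hf
      calc ∑' x : ℤ, (x.natAbs : ℝ≥0∞) * aliveMass r (t + 1) x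
          = ∑' x : ℤ, (x.natAbs : ℝ≥0∞) * f (x - 1) / 2 +
            ∑' x : ℤ, (x.natAbs : ℝ≥0∞) * f (x + 1) / 2 := by
            rw [← ENNReal.tsum_add]
            refine tsum_congr fun x => ?_
            simp only [aliveMass, hf, div_eq_mul_inv]
            ring
        _ = ∑' x : ℤ, ((x + 1).natAbs : ℝ≥0∞) * f x / 2 +
            ∑' x : ℤ, ((x - 1).natAbs : ℝ≥0∞) * f x / 2 := by
            congr 1
            · rw [← (Equiv.addRight (1 : ℤ)).tsum_eq]; simp
            · rw [← (Equiv.subRight (1 : ℤ)).tsum_eq]; simp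
        _ = ∑' x : ℤ, ((x.natAbs : ℝ≥0∞) * f x + if x = 0 then f 0 else 0) := by
            rw [← ENNReal.tsum_add]
            refine tsum_congr fun x => ?_
            have h2 : (((x + 1).natAbs + (x - 1).natAbs : ℕ) : ℝ≥0∞) / 2 =
                ((x.natAbs + if x = 0 then 1 else 0 : ℕ) : ℝ≥0∞) := by
              have : (x + 1).natAbs + (x - 1).natAbs =
                  (x.natAbs + if x = 0 then 1 else 0) * 2 := by split_ifs <;> omega
              rw [this, Nat.cast_mul, Nat.cast_two,
                ENNReal.mul_div_cancel_right (by simp) (by simp)]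
            calc _ = (((x + 1).natAbs + (x - 1).natAbs : ℕ) : ℝ≥0∞) / 2 * f x := by
                  rw [Nat.cast_add]; simp only [div_eq_mul_inv]; ring
              _ = _ := by
                  rw [h2]
                  split_ifs with hx
                  · simp [hx]
                  · simp
        _ = _ := by
            rw [ENNReal.tsum_add, tsum_ite_eq]
    rw [Finset.sum_range_succ, Finset.sum_range_succ, key, ← ih]
    have hsplit : ∑' x : ℤ, (x.natAbs : ℝ≥0∞) * aliveMass r t x =
        ∑' x : ℤ, (x.natAbs : ℝ≥0∞) * (heads r x * aliveMass r t x) +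
        ∑' x : ℤ, (x.natAbs : ℝ≥0∞) * (tails r x * aliveMass r t x) := by
      rw [← ENNReal.tsum_add]
      refine tsum_congr fun x => ?_
      rw [← mul_add, ← add_mul, add_comm (heads r x), tails_add_heads, one_mul]
    rw [hsplit]
    ring

/-! ### The potential of a centered measure -/

/-- The difference at `x` of the potentials `∫ |x - y| dμ(y)` and `|x|` of `μ` and of `δ₀`. -/
def potential (μ : Measure ℤ) (x : ℤ) : ℝ := ∫ y : ℤ, |(x : ℝ) - y| ∂μ - |(x : ℝ)|

theorem potential_zero (μ : Measure ℤ) : potential μ 0 = ∫ y : ℤ, |(y : ℝ)| ∂μ := by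
  simp [potential]

theorem abs_add_abs_int (z : ℤ) :
    (|(z : ℝ) - 1| + |(z : ℝ) + 1|) / 2 = |(z : ℝ)| + if z = 0 then 1 else 0 := by
  have h : |z - 1| + |z + 1| = 2 * (|z| + if z = 0 then 1 else 0) := by
    split_ifs with h
    · simp [h]
    · rcases lt_or_gt_of_ne h with h | h
      · rw [abs_of_neg h, abs_of_neg (by omega), abs_of_nonpos (by omega)]; ring
      · rw [abs_of_pos h, abs_of_nonneg (by omega), abs_of_pos (by omega)]; ring
  have h' : |(z : ℝ) - 1| + |(z : ℝ) + 1| = 2 * (|(z : ℝ)| + if z = 0 then 1 else 0) := by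
    exact_mod_cast h
  rw [h', mul_div_cancel_left₀ _ two_ne_zero]

section Potential

variable {μ : Measure ℤ} [IsProbabilityMeasure μ]

theorem IsCentered.integrable_sub (hμ : IsCentered μ) (x : ℤ) :
    Integrable (fun y : ℤ => (x : ℝ) - y) μ :=
  (integrable_const _).sub hμ.integrable

theorem IsCentered.integral_sub (hμ : IsCentered μ) (x : ℤ) :
    ∫ y : ℤ, ((x : ℝ) - y) ∂μ = x := by
  rw [MeasureTheory.integral_sub (integrable_const _) hμ.integrable, hμ.mean_zero]
  simp

theorem potential_nonneg (hμ : IsCentered μ) (x : ℤ) : 0 ≤ potential μ x := by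
  have h := abs_integral_le_integral_abs (f := fun y : ℤ => (x : ℝ) - y) (μ := μ)
  rw [hμ.integral_sub] at h
  exact sub_nonneg.2 h

/-- The second difference of the potential is that of `μ - δ₀`. -/
theorem potential_eq (hμ : IsCentered μ) (x : ℤ) :
    μ.real {x} + potential μ x = (if x = 0 then 1 else 0) +
      (potential μ (x - 1) + potential μ (x + 1)) / 2 := by
  have hI : ∫ y : ℤ, (|((x - 1 : ℤ) : ℝ) - y| + |((x + 1 : ℤ) : ℝ) - y|) / 2 ∂μ =
      ∫ y : ℤ, |(x : ℝ) - y| ∂μ + μ.real {x} := by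
    have h (y : ℤ) : (|((x - 1 : ℤ) : ℝ) - y| + |((x + 1 : ℤ) : ℝ) - y|) / 2 =
        |(x : ℝ) - y| + indicator {x} (fun _ => (1 : ℝ)) y := by
      have := abs_add_abs_int (x - y)
      push_cast at this ⊢
      rw [show (x : ℝ) - 1 - y = x - y - 1 by ring, show (x : ℝ) + 1 - y = x - y + 1 by ring, this]
      by_cases hxy : x = y
      · simp [hxy]
      · simp [sub_eq_zero, hxy, Ne.symm hxy]
    simp_rw [h]
    rw [integral_add (hμ.integrable_sub x).abs
      ((integrable_const _).indicator (measurableSet_singleton x)),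
      integral_indicator_const _ (measurableSet_singleton x)]
    simp
  rw [integral_div, integral_add (hμ.integrable_sub _).abs (hμ.integrable_sub _).abs] at hI
  have h0 := abs_add_abs_int x
  unfold potential
  push_cast at hI ⊢
  linarith

/-- For `x ≥ 0` the potential is `∫ (|x - y| - (x - y)) dμ(y)`, twice a call price. -/
theorem potential_eq_of_nonneg (hμ : IsCentered μ) {x : ℤ} (hx : 0 ≤ x) :
    potential μ x = ∫ y : ℤ, (|(x : ℝ) - y| - (x - y)) ∂μ := by
  rw [MeasureTheory.integral_sub (hμ.integrable_sub x).abs (hμ.integrable_sub x), hμ.integral_sub,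
    potential, abs_of_nonneg (a := (x : ℝ)) (by exact_mod_cast hx)]

/-- For `x ≤ 0` the potential is `∫ (|x - y| + (x - y)) dμ(y)`, twice a put price. -/
theorem potential_eq_of_nonpos (hμ : IsCentered μ) {x : ℤ} (hx : x ≤ 0) :
    potential μ x = ∫ y : ℤ, (|(x : ℝ) - y| + (x - y)) ∂μ := by
  rw [integral_add (hμ.integrable_sub x).abs (hμ.integrable_sub x), hμ.integral_sub,
    potential, abs_of_nonpos (a := (x : ℝ)) (by exact_mod_cast hx), sub_neg_eq_add]

theorem tendsto_potential_atTop (hμ : IsCentered μ) : Tendsto (potential μ) atTop (𝓝 0) := by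
  have h : Tendsto (fun x : ℤ => ∫ y : ℤ, (|(x : ℝ) - y| - |(x : ℝ)| + y) ∂μ) atTop
      (𝓝 (∫ _ : ℤ, (0 : ℝ) ∂μ)) := by
    refine tendsto_integral_filter_of_dominated_convergence (fun y : ℤ => 2 * |(y : ℝ)|)
      (.of_forall fun x => by fun_prop) (.of_forall fun x => .of_forall fun y => ?_)
      (hμ.integrable.abs.const_mul 2) (.of_forall fun y => ?_)
    · have h1 := abs_abs_sub_abs_le ((x : ℝ) - y) x
      rw [sub_sub_cancel_left, abs_neg] at h1
      rw [Real.norm_eq_abs]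
      exact (abs_add_le _ _).trans (by linarith)
    · refine tendsto_const_nhds.congr' ?_
      filter_upwards [eventually_ge_atTop (max 0 y)] with x hx
      have h0 : (0 : ℝ) ≤ x := by exact_mod_cast (le_max_left _ _).trans hx
      have h1 : (y : ℝ) ≤ x := by exact_mod_cast (le_max_right _ _).trans hx
      rw [abs_of_nonneg h0, abs_of_nonneg (sub_nonneg.2 h1)]
      ring
  rw [integral_zero] at h
  refine h.congr fun x => ?_
  have hint : Integrable (fun y : ℤ => |(x : ℝ) - y| - |(x : ℝ)|) μ :=
    (hμ.integrable_sub x).abs.sub (integrable_const _)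
  rw [integral_add hint hμ.integrable,
    MeasureTheory.integral_sub (hμ.integrable_sub x).abs (integrable_const _), hμ.mean_zero]
  simp [potential]

theorem tendsto_potential_atBot (hμ : IsCentered μ) : Tendsto (potential μ) atBot (𝓝 0) := by
  have h : Tendsto (fun x : ℤ => ∫ y : ℤ, (|(x : ℝ) - y| - |(x : ℝ)| - y) ∂μ) atBot
      (𝓝 (∫ _ : ℤ, (0 : ℝ) ∂μ)) := by
    refine tendsto_integral_filter_of_dominated_convergence (fun y : ℤ => 2 * |(y : ℝ)|)
      (.of_forall fun x => by fun_prop) (.of_forall fun x => .of_forall fun y => ?_)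
      (hμ.integrable.abs.const_mul 2) (.of_forall fun y => ?_)
    · have h1 := abs_abs_sub_abs_le ((x : ℝ) - y) x
      rw [sub_sub_cancel_left, abs_neg] at h1
      rw [Real.norm_eq_abs]
      exact (abs_sub _ _).trans (by linarith)
    · refine tendsto_const_nhds.congr' ?_
      filter_upwards [eventually_le_atBot (min 0 y)] with x hx
      have h0 : (x : ℝ) ≤ 0 := by exact_mod_cast hx.trans (min_le_left _ _)
      have h1 : (x : ℝ) ≤ y := by exact_mod_cast hx.trans (min_le_right _ _)
      rw [abs_of_nonpos h0, abs_of_nonpos (sub_nonpos.2 h1)]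
      ring
  rw [integral_zero] at h
  refine h.congr fun x => ?_
  have hint : Integrable (fun y : ℤ => |(x : ℝ) - y| - |(x : ℝ)|) μ :=
    (hμ.integrable_sub x).abs.sub (integrable_const _)
  rw [MeasureTheory.integral_sub hint hμ.integrable,
    MeasureTheory.integral_sub (hμ.integrable_sub x).abs (integrable_const _), hμ.mean_zero]
  simp [potential]

theorem potential_eq_zero_of_forall_le (hμ : IsCentered μ) {x : ℤ} (h : ∀ᵐ y ∂μ, y ≤ x) :
    potential μ x = 0 := by
  have h0 : ∫ y : ℤ, |(x : ℝ) - y| ∂μ = x := by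
    refine Eq.trans (integral_congr_ae ?_) (hμ.integral_sub x)
    filter_upwards [h] with y hy
    exact abs_of_nonneg (sub_nonneg.2 (by exact_mod_cast hy))
  have hx : (0 : ℝ) ≤ x := h0 ▸ integral_nonneg fun _ => abs_nonneg _
  rw [potential, h0, abs_of_nonneg hx, sub_self]

theorem potential_eq_zero_of_forall_ge (hμ : IsCentered μ) {x : ℤ} (h : ∀ᵐ y ∂μ, x ≤ y) :
    potential μ x = 0 := by
  have h0 : ∫ y : ℤ, |(x : ℝ) - y| ∂μ = -x := by
    refine Eq.trans (integral_congr_ae ?_) ((integral_neg _).trans (congrArg _ (hμ.integral_sub x)))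
    filter_upwards [h] with y hy
    exact abs_of_nonpos (sub_nonpos.2 (by exact_mod_cast hy))
  have hx : (0 : ℝ) ≤ -x := h0 ▸ integral_nonneg fun _ => abs_nonneg _
  rw [potential, h0, abs_of_nonpos (by linarith), sub_self]

/-- The potential is positive strictly between two atoms. -/
theorem potential_pos (hμ : IsCentered μ) {A B x : ℤ} (hA : 0 < μ {A}) (hB : 0 < μ {B})
    (hx : x ∈ Ioo A B) : 0 < potential μ x := by
  have hpos {f : ℤ → ℝ} (hf : Integrable f μ) (h0 : ∀ y, 0 ≤ f y) {z : ℤ} (hz : 0 < f z)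
      (hm : 0 < μ {z}) : 0 < ∫ y, f y ∂μ := by
    rw [integral_pos_iff_support_of_nonneg h0 hf]
    exact hm.trans_le (measure_mono (by simpa using hz.ne'))
  rcases le_total 0 x with h0 | h0
  · rw [potential_eq_of_nonneg hμ h0]
    refine hpos ((hμ.integrable_sub x).abs.sub (hμ.integrable_sub x))
      (fun y => sub_nonneg.2 (le_abs_self _)) (z := B) ?_ hB
    have : (x : ℝ) < B := by exact_mod_cast hx.2
    rw [abs_of_neg (by linarith)]
    linarith
  · rw [potential_eq_of_nonpos hμ h0]
    refine hpos ((hμ.integrable_sub x).abs.add (hμ.integrable_sub x))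
      (fun y => by linarith [neg_abs_le ((x : ℝ) - y)]) (z := A) ?_ hA
    have : (A : ℝ) < x := by exact_mod_cast hx.1
    rw [abs_of_pos (by linarith)]
    linarith

theorem potential_eq_zero_of_notMem_Ioo (hμ : IsCentered μ) {A B x : ℤ}
    (hAB : μ (Icc A B) = 1) (hx : x ∉ Ioo A B) : potential μ x = 0 := by
  have hae : ∀ᵐ y ∂μ, y ∈ Icc A B := (prob_compl_eq_zero_iff measurableSet_Icc).2 hAB
  rcases le_or_gt x A with h | h
  · exact potential_eq_zero_of_forall_ge hμ (hae.mono fun y hy => h.trans hy.1)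
  · exact potential_eq_zero_of_forall_le hμ
      (hae.mono fun y hy => hy.2.trans (not_lt.1 fun h' => hx ⟨h, h'⟩))

end Potential

/-! ### The stopping probabilities that embed a centered measure -/

/-- The stopping probability `μ{x} / (μ{x} + U(x))`, where `U` is the potential of `μ`. It is
written as `1 - U(x) / (μ{x} + U(x))`, so that it equals `1` where `μ{x} = U(x) = 0`, that is beyond
the support of `μ`. The value is clamped to the unit interval, which has no effect when `μ` is
centered. -/
def embeddingRate (μ : Measure ℤ) (x : ℤ) : I :=
  projIcc 0 1 zero_le_one (1 - potential μ x / (μ.real {x} + potential μ x))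

section EmbeddingRate

variable {μ : Measure ℤ} [IsProbabilityMeasure μ]

theorem coe_embeddingRate (hμ : IsCentered μ) (x : ℤ) :
    (embeddingRate μ x : ℝ) = 1 - potential μ x / (μ.real {x} + potential μ x) := by
  have h0 := potential_nonneg hμ x
  have h1 : potential μ x / (μ.real {x} + potential μ x) ≤ 1 :=
    div_le_one_of_le₀ (le_add_of_nonneg_left measureReal_nonneg) (by positivity)
  rw [embeddingRate, projIcc_of_mem zero_le_one ⟨sub_nonneg.2 h1, sub_le_self _ (by positivity)⟩]

theorem one_sub_embeddingRate_mul (hμ : IsCentered μ) (x : ℤ) :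
    (1 - (embeddingRate μ x : ℝ)) * (μ.real {x} + potential μ x) = potential μ x := by
  have h0 := potential_nonneg hμ x
  have h1 : 0 ≤ μ.real {x} := measureReal_nonneg
  rw [coe_embeddingRate hμ, sub_sub_cancel]
  exact div_mul_cancel_of_imp fun h => by linarith

theorem embeddingRate_mul (hμ : IsCentered μ) (x : ℤ) :
    (embeddingRate μ x : ℝ) * (μ.real {x} + potential μ x) = μ.real {x} := by
  linarith [one_sub_embeddingRate_mul hμ x]

/-- By minimality, the Green function is at most `μ{x} + U(x)`. -/
theorem green_embeddingRate_le (hμ : IsCentered μ) (x : ℤ) :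
    green (embeddingRate μ) x ≤ ENNReal.ofReal (μ.real {x} + potential μ x) := by
  have hh (y : ℤ) : heads (embeddingRate μ) y * ENNReal.ofReal (μ.real {y} + potential μ y) =
      ENNReal.ofReal (potential μ y) := by
    have : heads (embeddingRate μ) y = ENNReal.ofReal (1 - embeddingRate μ y) := by
      rw [← toReal_heads, ENNReal.ofReal_toReal (heads_ne_top _ _)]
    rw [this, ← ENNReal.ofReal_mul (sub_nonneg.2 (embeddingRate μ y).2.2),
      one_sub_embeddingRate_mul hμ]
  refine green_le_of_supersolution _ (fun y => ENNReal.ofReal (μ.real {y} + potential μ y))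
    (fun y => ?_) x
  have h1 := potential_nonneg hμ (y - 1)
  have h2 := potential_nonneg hμ (y + 1)
  rw [hh, hh, potential_eq hμ, ENNReal.ofReal_add (by split_ifs <;> simp) (by positivity),
    ENNReal.ofReal_div_of_pos two_pos, ENNReal.ofReal_add h1 h2]
  refine add_le_add ?_ (by simp)
  split_ifs <;> simp

theorem green_embeddingRate_ne_top (hμ : IsCentered μ) (x : ℤ) :
    green (embeddingRate μ) x ≠ ⊤ :=
  ne_top_of_le_ne_top ENNReal.ofReal_ne_top (green_embeddingRate_le hμ x)

/-- The Green function is in fact equal to `μ{x} + U(x)`: the part of the difference that survives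
the coin toss is convex and bounded by the potential, which vanishes at infinity. -/
theorem toReal_green_embeddingRate (hμ : IsCentered μ) (x : ℤ) :
    (green (embeddingRate μ) x).toReal = μ.real {x} + potential μ x := by
  set r := embeddingRate μ with hr
  set w : ℤ → ℝ := fun y => μ.real {y} + potential μ y - (green r y).toReal with hw
  set u : ℤ → ℝ := fun y => (1 - r y) * w y with hu
  have hr0 (y : ℤ) : (0 : ℝ) ≤ r y := (r y).2.1
  have hr1 (y : ℤ) : (0 : ℝ) ≤ 1 - r y := sub_nonneg.2 (r y).2.2
  have hw0 (y : ℤ) : 0 ≤ w y := sub_nonneg.2 <|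
    ENNReal.toReal_le_of_le_ofReal (add_nonneg measureReal_nonneg (potential_nonneg hμ y))
      (green_embeddingRate_le hμ y)
  have hu0 (y : ℤ) : 0 ≤ u y := mul_nonneg (hr1 y) (hw0 y)
  have hule (y : ℤ) : u y ≤ potential μ y := by
    have := mul_nonneg (hr1 y) (ENNReal.toReal_nonneg (a := green r y))
    simp only [hu, hw, mul_sub]
    rw [one_sub_embeddingRate_mul hμ]
    linarith
  have hrec (y : ℤ) : w y = (u (y - 1) + u (y + 1)) / 2 := by
    have h1 := toReal_green_eq (green_embeddingRate_ne_top hμ) y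
    have h2 := potential_eq hμ y
    have h3 := one_sub_embeddingRate_mul hμ (y - 1)
    have h4 := one_sub_embeddingRate_mul hμ (y + 1)
    simp only [hu, hw, mul_sub]
    rw [h2, h1, h3, h4]
    ring
  have hu_nonpos (y : ℤ) : u y ≤ 0 := by
    refine nonpos_of_subharmonic
      (squeeze_zero hu0 hule (tendsto_potential_atTop hμ))
      (squeeze_zero hu0 hule (tendsto_potential_atBot hμ)) (fun z _ => ?_) y
    have : u z ≤ w z := by
      have := mul_nonneg (hr0 z) (hw0 z)
      simp only [hu]
      linarith
    linarith [hrec z]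
  have : w x = 0 := le_antisymm (by linarith [hrec x, hu_nonpos (x - 1), hu_nonpos (x + 1)]) (hw0 x)
  linarith [sub_eq_zero.1 this]

/-- The mass stopped in each state is the one prescribed by `μ`. -/
theorem tails_mul_green_embeddingRate (hμ : IsCentered μ) (x : ℤ) :
    tails (embeddingRate μ) x * green (embeddingRate μ) x = μ {x} := by
  rw [← ENNReal.toReal_eq_toReal_iff' (ENNReal.mul_ne_top (tails_ne_top _ _)
    (green_embeddingRate_ne_top hμ x)) (measure_ne_top _ _), ENNReal.toReal_mul, toReal_tails,
    toReal_green_embeddingRate hμ, embeddingRate_mul hμ]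
  rfl

theorem heads_mul_green_embeddingRate (hμ : IsCentered μ) (x : ℤ) :
    heads (embeddingRate μ) x * green (embeddingRate μ) x = ENNReal.ofReal (potential μ x) := by
  rw [← ENNReal.toReal_eq_toReal_iff' (ENNReal.mul_ne_top (heads_ne_top _ _)
    (green_embeddingRate_ne_top hμ x)) ENNReal.ofReal_ne_top, ENNReal.toReal_mul, toReal_heads,
    toReal_green_embeddingRate hμ, one_sub_embeddingRate_mul hμ,
    ENNReal.toReal_ofReal (potential_nonneg hμ x)]

theorem embeddingRate_eq_one_of_notMem_Ioo (hμ : IsCentered μ) {A B x : ℤ}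
    (hAB : μ (Icc A B) = 1) (hx : x ∉ Ioo A B) : embeddingRate μ x = 1 := by
  ext
  simp [coe_embeddingRate hμ, potential_eq_zero_of_notMem_Ioo hμ hAB hx]

/-- Stopping probabilities that embed in each state of `(A, B)` at most the mass of `μ` are at most
those that embed `μ`: their surviving Green function exceeds the potential of `μ`, because the
difference is concave in `(A, B)` and vanishes elsewhere. -/
theorem le_embeddingRate (hμ : IsCentered μ) {A B : ℤ} (hAB : μ (Icc A B) = 1) (hA : 0 < μ {A})
    (hB : 0 < μ {B}) {r : ℤ → I} (hr : ∀ i ∉ Ioo A B, r i = 1)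
    (hle : ∀ i ∈ Ioo A B, tails r i * green r i ≤ μ {i}) : r ≤ embeddingRate μ := by
  have hG := green_ne_top_of_bounded hr
  have hν (x : ℤ) (hx : x ∈ Ioo A B) : r x * (green r x).toReal ≤ μ.real {x} := by
    rw [← toReal_tails, ← ENNReal.toReal_mul]
    exact ENNReal.toReal_mono (measure_ne_top _ _) (hle x hx)
  set d : ℤ → ℝ := fun x => potential μ x - (1 - r x) * (green r x).toReal with hd
  have hd0 (x : ℤ) (hx : x ∉ Ioo A B) : d x = 0 := by
    simp [hd, potential_eq_zero_of_notMem_Ioo hμ hAB hx, hr x hx]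
  have hd_nonpos (x : ℤ) : d x ≤ 0 := by
    refine nonpos_of_subharmonic ?_ ?_ (fun y hy => ?_) x
    · refine tendsto_const_nhds.congr' ?_
      filter_upwards [eventually_ge_atTop B] with y hy
      exact (hd0 y fun h => h.2.not_ge hy).symm
    · refine tendsto_const_nhds.congr' ?_
      filter_upwards [eventually_le_atBot A] with y hy
      exact (hd0 y fun h => h.1.not_ge hy).symm
    · have hyI : y ∈ Ioo A B := by
        by_contra h
        exact hy.ne' (hd0 y h)
      have h1 := toReal_green_eq hG y
      have h2 := potential_eq hμ y
      have h3 := hν y hyI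
      simp only [hd]
      linarith
  intro x
  by_cases hx : x ∈ Ioo A B
  · have hp := potential_pos hμ hA hB hx
    have hm : 0 ≤ μ.real {x} := measureReal_nonneg
    have hν' := hν x hx
    have hdx : potential μ x ≤ (1 - r x) * (green r x).toReal := sub_nonpos.1 (hd_nonpos x)
    have hr0 : (0 : ℝ) ≤ r x := (r x).2.1
    have hr1 : (0 : ℝ) ≤ 1 - r x := sub_nonneg.2 (r x).2.2
    rw [← Subtype.coe_le_coe, coe_embeddingRate hμ, le_sub_comm, div_le_iff₀ (by linarith)]
    -- `U = U r + U (1 - r) ≤ (1 - r) r G + U (1 - r)`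
    have h1 := mul_le_mul_of_nonneg_left hdx hr0
    have h2 := mul_le_mul_of_nonneg_left hν' hr1
    linarith
  · rw [hr x hx, embeddingRate_eq_one_of_notMem_Ioo hμ hAB hx]

end EmbeddingRate

/-! ### The walk and its stopping time -/

theorem coe_le_coinTime_iff {Ω : Type*} {S : ℕ → Ω → ℤ} {ξ : ℕ → ℤ → Ω → Fin 2}
    {t : ℕ} {ω : Ω} :
    WithTop.some t ≤ coinTime S ξ ω ↔ ∀ u < t, ξ u (S u ω) ω ≠ 0 := by
  rw [← not_lt, coinTime, hittingAfter_lt_iff]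
  simp

theorem coinTime_eq_coe_iff {Ω : Type*} {S : ℕ → Ω → ℤ} {ξ : ℕ → ℤ → Ω → Fin 2}
    {t : ℕ} {ω : Ω} :
    coinTime S ξ ω = WithTop.some t ↔ (∀ u < t, ξ u (S u ω) ω ≠ 0) ∧ ξ t (S t ω) ω = 0 := by
  have h : coinTime S ξ ω = WithTop.some t ↔
      WithTop.some t ≤ coinTime S ξ ω ∧ ¬ WithTop.some (t + 1) ≤ coinTime S ξ ω := by
    cases coinTime S ξ ω with
    | top => simp
    | coe n => norm_cast; omega
  rw [h, coe_le_coinTime_iff, coe_le_coinTime_iff]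
  refine and_congr_right fun h1 => ?_
  constructor
  · intro h2
    by_contra h3
    refine h2 fun u hu => ?_
    rcases Nat.lt_succ_iff_lt_or_eq.1 hu with hu | rfl
    · exact h1 u hu
    · exact h3
  · exact fun h2 h3 => h3 t t.lt_succ_self h2

section StoppedWalk

variable {Ω : Type*} [MeasurableSpace Ω] {P : Measure Ω}
  {S : ℕ → Ω → ℤ} {r : ℤ → I} {ξ : ℕ → ℤ → Ω → Fin 2}

theorem IsSimpleRandomWalk.measure_increment_eq_one (hS : IsSimpleRandomWalk P S) (t : ℕ) :
    P {ω | S (t + 1) ω - S t ω = 1} = 2⁻¹ := by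
  rw [(hS.law t).measure_eq (p := fun x => x = 1) .of_discrete]
  refine (bernoulliMeasure_apply_of_mem_of_notMem _ .of_discrete (by simp) (by simp)).trans ?_
  rw [← ENNReal.toReal_eq_toReal_iff' ENNReal.coe_ne_top (by simp)]
  simp [half]

theorem IsSimpleRandomWalk.measure_increment_eq_neg_one (hS : IsSimpleRandomWalk P S) (t : ℕ) :
    P {ω | S (t + 1) ω - S t ω = -1} = 2⁻¹ := by
  rw [(hS.law t).measure_eq (p := fun x => x = -1) .of_discrete]
  refine (bernoulliMeasure_apply_of_notMem_of_mem _ .of_discrete (by simp) (by simp)).trans ?_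
  rw [← ENNReal.toReal_eq_toReal_iff' ENNReal.coe_ne_top (by simp)]
  norm_num [half]

theorem IsSimpleRandomWalk.ae_increment (hS : IsSimpleRandomWalk P S) (t : ℕ) :
    ∀ᵐ ω ∂P, S (t + 1) ω - S t ω = 1 ∨ S (t + 1) ω - S t ω = -1 := by
  have h : P {ω | ¬(S (t + 1) ω - S t ω = 1 ∨ S (t + 1) ω - S t ω = -1)} = 0 := by
    rw [(hS.law t).measure_eq (p := fun x => ¬(x = 1 ∨ x = -1)) .of_discrete]
    exact bernoulliMeasure_apply_of_notMem_of_notMem _ .of_discrete (by simp) (by simp)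
  exact h

theorem IsCoinFamily.measure_tails (hξ : IsCoinFamily P S r ξ) (t : ℕ) (x : ℤ) :
    P {ω | ξ t x ω ∈ ({0} : Set (Fin 2))} = tails r x := by
  rw [(hξ.law t x).measure_eq (p := fun i => i ∈ ({0} : Set (Fin 2))) .of_discrete]
  exact bernoulliMeasure_apply_of_mem_of_notMem _ .of_discrete (by simp) (by simp)

theorem IsCoinFamily.measure_heads (hξ : IsCoinFamily P S r ξ) (t : ℕ) (x : ℤ) :
    P {ω | ξ t x ω ∈ ({0}ᶜ : Set (Fin 2))} = heads r x := by
  rw [(hξ.law t x).measure_eq (p := fun i => i ∈ ({0}ᶜ : Set (Fin 2))) .of_discrete]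
  exact bernoulliMeasure_apply_of_notMem_of_mem _ .of_discrete (by simp) (by simp)

/-- The walk up to time `t` is independent of its next increment. -/
theorem IsSimpleRandomWalk.indepFun_path (hS : IsSimpleRandomWalk P S) (t : ℕ) :
    IndepFun (fun ω u => S (min u t) ω) (fun ω => S (t + 1) ω - S t ω) P := by
  have hD (i : ℕ) : Measurable fun ω => S (i + 1) ω - S i ω :=
    (hS.measurable _).sub (hS.measurable _)
  have h := hS.indep.indepFun_finset (Finset.range t) {t} (by simp) hD
  have hlast : Measurable fun d : ({t} : Finset ℕ) → ℤ => d ⟨t, Finset.mem_singleton_self t⟩ :=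
    measurable_pi_apply _
  have h' := h.comp
    (φ := fun d u => ∑ i : Finset.range t, if (i : ℕ) < min u t then d i else 0)
    (measurable_pi_lambda _ fun u => Finset.measurable_sum _ fun i _ => by
      split_ifs
      · exact measurable_pi_apply i
      · exact measurable_const)
    hlast
  -- The increments before time `t` add up to the path because `S 0 = 0` almost surely.
  refine h'.congr ?_ .rfl
  filter_upwards [hS.start] with ω hω
  funext u
  simp only [Function.comp_apply]
  rw [Finset.sum_coe_sort (Finset.range t)
    (fun i => if i < min u t then S (i + 1) ω - S i ω else 0), ← Finset.sum_filter]
  have hr : (Finset.range t).filter (fun i => i < min u t) = Finset.range (min u t) := by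
    ext i
    simp
  rw [hr, Finset.sum_range_sub (fun i => S i ω), hω, sub_zero]

variable [IsProbabilityMeasure P]

/-- The Feynman–Kac representation of the mass function of the walk before stopping. -/
theorem IsSimpleRandomWalk.lintegral_prod_heads (hS : IsSimpleRandomWalk P S) (r : ℤ → I) (t : ℕ)
    (x : ℤ) :
    ∫⁻ ω, (if S t ω = x then ∏ u ∈ Finset.range t, heads r (S u ω) else 0) ∂P =
      aliveMass r t x := by
  induction t generalizing x with
  | zero =>
    have h : ∀ᵐ ω ∂P, (if S 0 ω = x then ∏ u ∈ Finset.range 0, heads r (S u ω) else 0) =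
        if x = 0 then (1 : ℝ≥0∞) else 0 := by
      filter_upwards [hS.start] with ω hω
      simp [hω, eq_comm]
    rw [lintegral_congr_ae h]
    simp [aliveMass]
  | succ t ih =>
    set Φ : ℤ → (ℕ → ℤ) → ℝ≥0∞ := fun y s =>
      if s t = y then ∏ u ∈ Finset.range t, heads r (s u) else 0 with hΦ
    have hΦm (y : ℤ) : Measurable (Φ y) :=
      Measurable.ite (measurableSet_eq_fun (measurable_pi_apply t) measurable_const)
        (Finset.measurable_prod _ fun u _ =>
          (Measurable.of_discrete (f := heads r)).comp (measurable_pi_apply u)) measurable_const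
    set f : ℤ → Ω → ℝ≥0∞ := fun y ω =>
      if S t ω = y then ∏ u ∈ Finset.range t, heads r (S u ω) else 0 with hf
    have hfΦ (y : ℤ) : f y = Φ y ∘ fun ω u => S (min u t) ω := by
      funext ω
      simp only [hf, hΦ, Function.comp_apply, min_self]
      congr 1
      refine Finset.prod_congr rfl fun u hu => ?_
      rw [min_eq_left (Finset.mem_range.1 hu).le]
    have hpath : Measurable fun ω u => S (min u t) ω :=
      measurable_pi_lambda _ fun u => hS.measurable _
    have hfm (y : ℤ) : Measurable (f y) := hfΦ y ▸ (hΦm y).comp hpath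
    -- The event `S t = y` and the weight up to time `t` are independent of the next increment.
    have hstep (y d : ℤ) (hd : P {ω | S (t + 1) ω - S t ω = d} = 2⁻¹) :
        ∫⁻ ω, f y ω * (if S (t + 1) ω - S t ω = d then 1 else 0) ∂P = aliveMass r t y * 2⁻¹ := by
      have hind : Measurable fun z : ℤ => if z = d then (1 : ℝ≥0∞) else 0 := .of_discrete
      have hD : Measurable fun ω => S (t + 1) ω - S t ω :=
        (hS.measurable (t + 1)).sub (hS.measurable t)
      have hi := (hS.indepFun_path t).comp (hΦm y) hind
      rw [← hfΦ] at hi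
      refine (lintegral_mul_eq_lintegral_mul_lintegral_of_indepFun (hfm y) (hind.comp hD) hi).trans
        ?_
      rw [ih y, ← hd, ← lintegral_indicator_one (measurableSet_eq_fun hD measurable_const)]
      congr 1
      exact lintegral_congr fun ω => by simp [indicator_apply]
    have hsplit : ∀ᵐ ω ∂P,
        (if S (t + 1) ω = x then ∏ u ∈ Finset.range (t + 1), heads r (S u ω) else 0) =
        heads r (x - 1) * (f (x - 1) ω * if S (t + 1) ω - S t ω = 1 then 1 else 0) +
        heads r (x + 1) * (f (x + 1) ω * if S (t + 1) ω - S t ω = -1 then 1 else 0) := by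
      filter_upwards [hS.ae_increment t] with ω hω
      simp only [hf, Finset.prod_range_succ]
      rcases hω with h | h
      · have h1 : S (t + 1) ω = x ↔ S t ω = x - 1 := by omega
        rw [if_pos h, if_neg (by omega : ¬S (t + 1) ω - S t ω = -1)]
        simp only [h1, mul_one, mul_zero, add_zero]
        split_ifs with h2
        · rw [h2, mul_comm]
        · rw [mul_zero]
      · have h1 : S (t + 1) ω = x ↔ S t ω = x + 1 := by omega
        rw [if_pos h, if_neg (by omega : ¬S (t + 1) ω - S t ω = 1)]
        simp only [h1, mul_one, mul_zero, zero_add]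
        split_ifs with h2
        · rw [h2, mul_comm]
        · rw [mul_zero]
    have hmeas (y d : ℤ) : Measurable fun ω =>
        f y ω * (if S (t + 1) ω - S t ω = d then 1 else 0) :=
      (hfm y).mul (Measurable.ite (measurableSet_eq_fun
        ((hS.measurable (t + 1)).sub (hS.measurable t)) measurable_const)
        measurable_const measurable_const)
    rw [lintegral_congr_ae hsplit, lintegral_add_left ((hmeas _ _).const_mul _),
      lintegral_const_mul _ (hmeas _ _), lintegral_const_mul _ (hmeas _ _),
      hstep _ _ (hS.measure_increment_eq_one t), hstep _ _ (hS.measure_increment_eq_neg_one t)]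
    simp only [aliveMass, div_eq_mul_inv]
    ring

/-- Conditionally on the walk, the coins tossed along its path are independent. -/
theorem IsCoinFamily.measure_path_inter (hS : IsSimpleRandomWalk P S) (hξ : IsCoinFamily P S r ξ)
    (n : ℕ) (B : ℕ → Set (Fin 2)) (t : ℕ) (x : ℤ) :
    P {ω | S t ω = x ∧ ∀ u ∈ Finset.range n, ξ u (S u ω) ω ∈ B u} =
      ∫⁻ ω, (if S t ω = x then
        ∏ u ∈ Finset.range n, P {ω' | ξ u (S u ω) ω' ∈ B u} else 0) ∂P := by
  set X : Ω → ℕ → ℤ := fun ω u => S u ω with hX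
  set Y : Ω → ℕ × ℤ → Fin 2 := fun ω p => ξ p.1 p.2 ω with hY
  have hXm : Measurable X := measurable_pi_lambda _ hS.measurable
  have hYm : Measurable Y := measurable_pi_lambda _ fun p => hξ.measurable p.1 p.2
  set K : Set ((ℕ → ℤ) × (ℕ × ℤ → Fin 2)) :=
    {p | p.1 t = x ∧ ∀ u ∈ Finset.range n, p.2 (u, p.1 u) ∈ B u} with hK
  have hKm : MeasurableSet K := by
    have hcoin (u : ℕ) : Measurable fun p : (ℕ → ℤ) × (ℕ × ℤ → Fin 2) => p.2 (u, p.1 u) :=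
      (measurable_from_prod_countable_right
        (f := fun q : ℤ × (ℕ × ℤ → Fin 2) => q.2 (u, q.1))
        (fun y => measurable_pi_apply (u, y))).comp
        (((measurable_pi_apply u).comp (measurable_fst (α := ℕ → ℤ))).prodMk measurable_snd)
    have hcoins : {p : (ℕ → ℤ) × (ℕ × ℤ → Fin 2) | ∀ u ∈ Finset.range n, p.2 (u, p.1 u) ∈ B u} =
        ⋂ u ∈ Finset.range n, (fun p => p.2 (u, p.1 u)) ⁻¹' B u := by
      ext p
      simp
    refine MeasurableSet.inter
      (measurableSet_eq_fun ((measurable_pi_apply t).comp measurable_fst) measurable_const)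
      (MeasurableSet.congr ?_ hcoins.symm)
    exact Finset.measurableSet_biInter _ fun u _ => hcoin u .of_discrete
  have hmap := hξ.indep_walk.map_prod_eq_prod_map_map hXm.aemeasurable hYm.aemeasurable
  have hleft : P {ω | S t ω = x ∧ ∀ u ∈ Finset.range n, ξ u (S u ω) ω ∈ B u} =
      P.map (fun ω => (X ω, Y ω)) K := by
    rw [Measure.map_apply (hXm.prodMk hYm) hKm]
    rfl
  have : IsProbabilityMeasure (P.map Y) := Measure.isProbabilityMeasure_map hYm.aemeasurable
  rw [hleft, hmap, Measure.prod_apply hKm, lintegral_map (measurable_measure_prodMk_left hKm) hXm]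
  refine lintegral_congr fun ω => ?_
  rw [Measure.map_apply hYm (measurable_prodMk_left hKm)]
  split_ifs with h
  -- Along a fixed path the coins have distinct indices, as their times differ.
  · have hinj : Function.Injective fun u : ℕ => (u, S u ω) := fun a b hab => (Prod.ext_iff.1 hab).1
    have hprod := (hξ.indep.precomp hinj).measure_inter_preimage_eq_mul (Finset.range n)
      (sets := B) (fun _ _ => .of_discrete)
    refine Eq.trans (congrArg P ?_) hprod
    ext ω'
    simp [hK, hX, hY, h]
  · have : Y ⁻¹' (Prod.mk (X ω) ⁻¹' K) = ∅ := by
      ext ω'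
      simp [hK, hX, h]
    rw [this, measure_empty]

/-- The mass function of the walk before stopping is given by the recursion `aliveMass`. -/
theorem measure_alive (hS : IsSimpleRandomWalk P S) (hξ : IsCoinFamily P S r ξ) (t : ℕ) (x : ℤ) :
    P {ω | S t ω = x ∧ ∀ u < t, ξ u (S u ω) ω ≠ 0} = aliveMass r t x := by
  have h := hξ.measure_path_inter hS t (fun _ => {0}ᶜ) t x
  simp only [hξ.measure_heads, hS.lintegral_prod_heads] at h
  rw [← h]
  simp

theorem measure_stop (hS : IsSimpleRandomWalk P S) (hξ : IsCoinFamily P S r ξ) (t : ℕ) (x : ℤ) :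
    P {ω | S t ω = x ∧ (∀ u < t, ξ u (S u ω) ω ≠ 0) ∧ ξ t (S t ω) ω = 0} =
      tails r x * aliveMass r t x := by
  have h := hξ.measure_path_inter hS (t + 1) (fun u => if u = t then {0} else {0}ᶜ) t x
  have hprod (ω : Ω) : (if S t ω = x then ∏ u ∈ Finset.range (t + 1),
        P {ω' | ξ u (S u ω) ω' ∈ if u = t then ({0} : Set (Fin 2)) else {0}ᶜ} else 0) =
      tails r x * if S t ω = x then ∏ u ∈ Finset.range t, heads r (S u ω) else 0 := by
    split_ifs with hx
    · rw [Finset.prod_range_succ, mul_comm, if_pos rfl, hξ.measure_tails, hx]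
      congr 1
      refine Finset.prod_congr rfl fun u hu => ?_
      rw [if_neg (Finset.mem_range.1 hu).ne, hξ.measure_heads]
    · rw [mul_zero]
  simp only [hprod] at h
  rw [lintegral_const_mul' _ _ (tails_ne_top r x), hS.lintegral_prod_heads] at h
  rw [← h]
  congr 1
  ext ω
  simp only [mem_ofPred_eq, Finset.mem_range, Nat.lt_succ_iff_lt_or_eq]
  refine and_congr_right fun _ => ⟨fun h u hu => ?_, fun h => ⟨fun u hu => ?_, ?_⟩⟩
  · rcases hu with hu | rfl
    · simpa [hu.ne] using h.1 u hu
    · simpa using h.2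
  · simpa [hu.ne] using h u (Or.inl hu)
  · simpa using h t (Or.inr rfl)

theorem isStoppingTime_coinTime (hS : ∀ t, Measurable (S t)) (hξ : ∀ t x, Measurable (ξ t x)) :
    IsStoppingTime (coinFiltration S ξ hS hξ) (coinTime S ξ) := by
  refine Adapted.isStoppingTime_hittingAfter (fun t => ?_) (measurableSet_singleton 0)
  refine Measurable.mono (comap_measurable _) ?_ le_rfl
  exact le_sup_right.trans (le_iSup₂ (f := fun u (_ : u ≤ t) =>
    MeasurableSpace.comap (S u) inferInstance ⊔
    MeasurableSpace.comap (fun ω => ξ u (S u ω) ω) inferInstance) t le_rfl)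

theorem measurable_coinTime (hS : ∀ t, Measurable (S t)) (hξ : ∀ t x, Measurable (ξ t x)) :
    Measurable (coinTime S ξ) :=
  (isStoppingTime_coinTime hS hξ).measurable'

theorem measurable_comp_time (hS : ∀ t, Measurable (S t)) {T : Ω → ℕ} (hT : Measurable T) :
    Measurable fun ω => S (T ω) ω :=
  (measurable_from_prod_countable_right (f := fun p : ℕ × Ω => S p.1 p.2) hS).comp
    (hT.prodMk measurable_id)

theorem measurable_stoppedValue_coinTime (hS : ∀ t, Measurable (S t))
    (hξ : ∀ t x, Measurable (ξ t x)) : Measurable (stoppedValue S (coinTime S ξ)) :=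
  measurable_comp_time hS (measurable_coinTime hS hξ).untopA

/-- The probability of being stopped in state `x` is the stopping probability times the Green
function. -/
theorem measure_stoppedValue_eq (hS : IsSimpleRandomWalk P S) (hξ : IsCoinFamily P S r ξ) (x : ℤ) :
    P {ω | coinTime S ξ ω ≠ ⊤ ∧ stoppedValue S (coinTime S ξ) ω = x} = tails r x * green r x := by
  have hunion : {ω | coinTime S ξ ω ≠ ⊤ ∧ stoppedValue S (coinTime S ξ) ω = x} =
      ⋃ t : ℕ, {ω | S t ω = x ∧ coinTime S ξ ω = WithTop.some t} := by
    ext ω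
    simp only [mem_ofPred_eq, mem_iUnion, stoppedValue]
    cases coinTime S ξ ω with
    | top => simp
    | coe n =>
      simp
      rfl
  rw [hunion, measure_iUnion, green, ← ENNReal.tsum_mul_left]
  · refine tsum_congr fun t => ?_
    simp_rw [coinTime_eq_coe_iff]
    exact measure_stop hS hξ t x
  · intro s t hst
    refine Set.disjoint_left.2 fun ω hs ht => hst ?_
    exact_mod_cast hs.2.symm.trans ht.2
  · exact fun t => (hS.measurable t (measurableSet_singleton x)).inter
      (measurable_coinTime hS.measurable hξ.measurable (measurableSet_singleton _))

end StoppedWalk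

theorem stopProb_eq (r : ℤ → I) (x : ℤ) : stopProb r x = tails r x * green r x :=
  measure_stoppedValue_eq (isSimpleRandomWalk_coinWalk r) (isCoinFamily_coin r) x

/-! ### The embedding -/

section Embedding

theorem enorm_intCast (z : ℤ) : ‖(z : ℝ)‖ₑ = (z.natAbs : ℝ≥0∞) := by
  rw [Real.enorm_eq_ofReal_abs, ← Int.cast_abs, ← Nat.cast_natAbs, ENNReal.ofReal_natCast]

theorem lintegral_natAbs {μ : Measure ℤ} (hμ : IsCentered μ) :
    ∫⁻ y : ℤ, (y.natAbs : ℝ≥0∞) ∂μ = ENNReal.ofReal (potential μ 0) := by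
  rw [potential_zero, ofReal_integral_eq_lintegral_ofReal hμ.integrable.abs
    (.of_forall fun _ => abs_nonneg _)]
  exact lintegral_congr fun y => by rw [← enorm_intCast, Real.enorm_eq_ofReal_abs]

variable {μ : Measure ℤ} [IsProbabilityMeasure μ]

/-- The first absolute moment of the stopped walk, split into the part that is not yet stopped and
the part already stopped, is at most `U(0) = ∫ |y| dμ(y)`. -/
theorem tsum_natAbs_mul_aliveMass_le (hμ : IsCentered μ) (t : ℕ) :
    ∑' x : ℤ, (x.natAbs : ℝ≥0∞) * aliveMass (embeddingRate μ) t x +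
      ∑ s ∈ Finset.range t, ∑' x : ℤ,
        (x.natAbs : ℝ≥0∞) * (tails (embeddingRate μ) x * aliveMass (embeddingRate μ) s x) ≤
      ENNReal.ofReal (potential μ 0) := by
  rw [moment_balance, ← heads_mul_green_embeddingRate hμ, green, ← ENNReal.tsum_mul_left]
  exact ENNReal.sum_le_tsum _

/-- The first absolute moment of the walk not yet stopped tends to `0`: the absolute moment of the
stopped walk never exceeds `∫ |y| dμ(y)`, and the part already stopped exhausts this bound. -/
theorem tendsto_tsum_natAbs_mul_aliveMass (hμ : IsCentered μ) :
    Tendsto (fun t => ∑' x : ℤ, (x.natAbs : ℝ≥0∞) * aliveMass (embeddingRate μ) t x) atTop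
      (𝓝 0) := by
  set L := ENNReal.ofReal (potential μ 0) with hL
  have hLtop : L ≠ ⊤ := ENNReal.ofReal_ne_top
  set b : ℕ → ℝ≥0∞ := fun s => ∑' x : ℤ,
    (x.natAbs : ℝ≥0∞) * (tails (embeddingRate μ) x * aliveMass (embeddingRate μ) s x) with hb
  have hsum : ∑' s, b s = L := by
    rw [hb, ENNReal.tsum_comm, hL, ← lintegral_natAbs hμ, lintegral_countable']
    refine tsum_congr fun x => ?_
    rw [ENNReal.tsum_mul_left, ENNReal.tsum_mul_left, ← tails_mul_green_embeddingRate hμ x, green]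
  have hle (t : ℕ) : ∑ s ∈ Finset.range t, b s ≤ L := le_add_self.trans
    (tsum_natAbs_mul_aliveMass_le hμ t)
  have hlim : Tendsto (fun t => L - ∑ s ∈ Finset.range t, b s) atTop (𝓝 0) := by
    have := ENNReal.Tendsto.sub (tendsto_const_nhds (x := L))
      (ENNReal.tendsto_nat_tsum b) (Or.inl hLtop)
    rwa [hsum, tsub_self] at this
  refine tendsto_of_tendsto_of_tendsto_of_le_of_le tendsto_const_nhds hlim (fun _ => zero_le)
    fun t => ?_
  exact ENNReal.le_sub_of_add_le_right (ne_top_of_le_ne_top hLtop (hle t))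
    (tsum_natAbs_mul_aliveMass_le hμ t)

variable {Ω : Type*} [MeasurableSpace Ω] {P : Measure Ω} [IsProbabilityMeasure P]
  {S : ℕ → Ω → ℤ} {ξ : ℕ → ℤ → Ω → Fin 2}

theorem lintegral_alive {r : ℤ → I} (hS : IsSimpleRandomWalk P S) (hξ : IsCoinFamily P S r ξ)
    (t : ℕ) :
    ∫⁻ ω, {ω | WithTop.some t ≤ coinTime S ξ ω}.indicator (fun ω => ‖(S t ω : ℝ)‖ₑ) ω ∂P =
      ∑' x : ℤ, (x.natAbs : ℝ≥0∞) * aliveMass r t x := by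
  have hm : MeasurableSet {ω | WithTop.some t ≤ coinTime S ξ ω} :=
    measurable_coinTime hS.measurable hξ.measurable measurableSet_Ici
  simp_rw [enorm_intCast]
  rw [lintegral_indicator hm,
    ← lintegral_map (f := fun x : ℤ => (x.natAbs : ℝ≥0∞)) .of_discrete (hS.measurable t),
    lintegral_countable']
  refine tsum_congr fun x => ?_
  rw [Measure.map_apply (hS.measurable t) (measurableSet_singleton x),
    Measure.restrict_apply (hS.measurable t (measurableSet_singleton x)), ← measure_alive hS hξ t x]
  simp_rw [← coe_le_coinTime_iff]
  rfl

/-- The law of the stopped value on the event that the walk is stopped. Since its total mass is `1`,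
that event has probability `1`. -/
theorem map_restrict_stoppedValue (hμ : IsCentered μ) (hS : IsSimpleRandomWalk P S)
    (hξ : IsCoinFamily P S (embeddingRate μ) ξ) :
    (P.restrict {ω | coinTime S ξ ω ≠ ⊤}).map (stoppedValue S (coinTime S ξ)) = μ := by
  have hm := measurable_stoppedValue_coinTime hS.measurable hξ.measurable
  refine Measure.ext_of_singleton fun x => ?_
  rw [Measure.map_apply hm (measurableSet_singleton x),
    Measure.restrict_apply (hm (measurableSet_singleton x)), inter_comm,
    ← tails_mul_green_embeddingRate hμ x, ← measure_stoppedValue_eq hS hξ x]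
  rfl

theorem ae_coinTime_ne_top (hμ : IsCentered μ) (hS : IsSimpleRandomWalk P S)
    (hξ : IsCoinFamily P S (embeddingRate μ) ξ) : ∀ᵐ ω ∂P, coinTime S ξ ω ≠ ⊤ := by
  have hm := measurable_stoppedValue_coinTime hS.measurable hξ.measurable
  have hfin : MeasurableSet {ω | coinTime S ξ ω ≠ ⊤} :=
    (measurable_coinTime hS.measurable hξ.measurable (measurableSet_singleton ⊤)).compl
  have h := congrArg (fun ν : Measure ℤ => ν univ) (map_restrict_stoppedValue hμ hS hξ)
  simp only [Measure.map_apply hm .univ, preimage_univ, Measure.restrict_apply .univ, univ_inter,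
    measure_univ] at h
  exact (prob_compl_eq_zero_iff hfin).2 h

theorem hasLaw_stoppedValue (hμ : IsCentered μ) (hS : IsSimpleRandomWalk P S)
    (hξ : IsCoinFamily P S (embeddingRate μ) ξ) :
    HasLaw (stoppedValue S (coinTime S ξ)) μ P where
  aemeasurable := (measurable_stoppedValue_coinTime hS.measurable hξ.measurable).aemeasurable
  map_eq := by
    conv_rhs => rw [← map_restrict_stoppedValue hμ hS hξ]
    rw [Measure.restrict_eq_self_of_ae_mem (s := {ω | coinTime S ξ ω ≠ ⊤})
      (ae_coinTime_ne_top hμ hS hξ)]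

/-- The stopped process converges in `L¹` to the embedded value, hence is uniformly integrable. -/
theorem uniformIntegrable_stoppedProcess (hμ : IsCentered μ) (hS : IsSimpleRandomWalk P S)
    (hξ : IsCoinFamily P S (embeddingRate μ) ξ) :
    UniformIntegrable (stoppedProcess (fun t ω => (S t ω : ℝ)) (coinTime S ξ)) 1 P := by
  set τ := coinTime S ξ with hτdef
  have hτ : Measurable τ := measurable_coinTime hS.measurable hξ.measurable
  set X : Ω → ℝ := fun ω => ((stoppedValue S τ ω : ℤ) : ℝ) with hX
  set M : ℕ → Ω → ℝ := stoppedProcess (fun t ω => (S t ω : ℝ)) τ with hM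
  set L := ENNReal.ofReal (potential μ 0) with hL
  have hLtop : L ≠ ⊤ := ENNReal.ofReal_ne_top
  have hXm : Measurable X := (Measurable.of_discrete (f := fun z : ℤ => (z : ℝ))).comp
    (measurable_stoppedValue_coinTime hS.measurable hξ.measurable)
  have hMm (t : ℕ) : Measurable (M t) :=
    (Measurable.of_discrete (f := fun z : ℤ => (z : ℝ))).comp
      (measurable_comp_time hS.measurable (measurable_const.min hτ).untopA)
  have hXL : ∫⁻ ω, ‖X ω‖ₑ ∂P = L := by
    simp_rw [hX, enorm_intCast]
    rw [hL, ← lintegral_natAbs hμ, ← (hasLaw_stoppedValue hμ hS hξ).map_eq,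
      lintegral_map .of_discrete
        (measurable_stoppedValue_coinTime hS.measurable hξ.measurable)]
  have hXLp : MemLp X 1 P :=
    ⟨hXm.aestronglyMeasurable, by rw [eLpNorm_one_eq_lintegral_enorm, hXL]; exact hLtop.lt_top⟩
  set E : ℕ → Set Ω := fun t => {ω | WithTop.some t ≤ τ ω} with hE
  have hEm (t : ℕ) : MeasurableSet (E t) := hτ measurableSet_Ici
  set a : ℕ → ℝ≥0∞ := fun t => ∫⁻ ω, (E t).indicator (fun ω => ‖(S t ω : ℝ)‖ₑ) ω ∂P with ha
  set b : ℕ → ℝ≥0∞ := fun t => ∫⁻ ω, (E t).indicator (fun ω => ‖X ω‖ₑ) ω ∂P with hb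
  have ha_le (t : ℕ) : a t ≤ L := by
    simp only [ha, hE, hτdef]
    rw [lintegral_alive hS hξ]
    exact le_self_add.trans (tsum_natAbs_mul_aliveMass_le hμ t)
  have ha_lim : Tendsto a atTop (𝓝 0) := by
    simp only [ha, hE, hτdef, lintegral_alive hS hξ]
    exact tendsto_tsum_natAbs_mul_aliveMass hμ
  have hb_le (t : ℕ) : b t ≤ L := hXL ▸ lintegral_mono (indicator_le_self _ _)
  have hb_lim : Tendsto b atTop (𝓝 0) := by
    have h := tendsto_lintegral_of_dominated_convergence (μ := P) (f := fun _ => 0)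
      (F := fun t ω => (E t).indicator (fun ω => ‖X ω‖ₑ) ω) (fun ω => ‖X ω‖ₑ)
      (fun t => hXm.enorm.indicator (hEm t)) (fun t => .of_forall (indicator_le_self _ _))
      (hXL ▸ hLtop) ?_
    · simpa using h
    · filter_upwards [ae_coinTime_ne_top hμ hS hξ] with ω hω
      obtain ⟨n, hn⟩ := WithTop.ne_top_iff_exists.1 hω
      refine tendsto_const_nhds.congr' ?_
      filter_upwards [eventually_gt_atTop n] with t ht
      have : ω ∉ E t := by
        simp only [hE, mem_ofPred_eq, hτdef, ← hn, WithTop.coe_le_coe]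
        omega
      rw [indicator_of_notMem this]
  have hdiff (t : ℕ) : eLpNorm (M t - X) 1 P ≤ a t + b t := by
    rw [eLpNorm_one_eq_lintegral_enorm, ha, hb, ← lintegral_add_right _
      (hXm.enorm.indicator (hEm t))]
    refine lintegral_mono fun ω => ?_
    by_cases hω : ω ∈ E t
    · simp only [indicator_of_mem hω, Pi.sub_apply]
      rw [hM, stoppedProcess_eq_of_le hω]
      exact enorm_sub_le
    · have : M t ω = X ω := by
        rw [hM, stoppedProcess_eq_of_ge (not_le.1 hω).le]
        rfl
      simp [this]
  have hdiffLp (t : ℕ) : MemLp (M t - X) 1 P :=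
    ⟨((hMm t).sub hXm).aestronglyMeasurable, (hdiff t).trans_lt
      (ENNReal.add_lt_top.2 ⟨(ha_le t).trans_lt hLtop.lt_top, (hb_le t).trans_lt hLtop.lt_top⟩)⟩
  have hMLp (t : ℕ) : MemLp (M t) 1 P := by simpa using (hdiffLp t).add hXLp
  refine ⟨fun t => (hMm t).aestronglyMeasurable,
    unifIntegrable_of_tendsto_Lp le_rfl ENNReal.one_ne_top hMLp hXLp ?_, (L + L + L).toNNReal,
    fun t => ?_⟩
  · have := ha_lim.add hb_lim
    rw [add_zero] at this
    exact tendsto_of_tendsto_of_tendsto_of_le_of_le tendsto_const_nhds this (fun _ => zero_le) hdiff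
  · rw [ENNReal.coe_toNNReal (by simp [hLtop])]
    calc eLpNorm (M t) 1 P = eLpNorm (M t - X + X) 1 P := by rw [sub_add_cancel]
      _ ≤ eLpNorm (M t - X) 1 P + eLpNorm X 1 P :=
        eLpNorm_add_le (hdiffLp t).1 hXLp.1 le_rfl
      _ ≤ L + L + L := by
        gcongr
        · exact (hdiff t).trans (add_le_add (ha_le t) (hb_le t))
        · rw [eLpNorm_one_eq_lintegral_enorm, hXL]

end Embedding

end RandomizedEmbedding

end

open RandomizedEmbedding in
theorem theorem1 (μ : Measure ℤ) [IsProbabilityMeasure μ] (hμ : IsCentered μ) :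
    ∃ r : ℤ → I,
      (∀ (Ω : Type*) [MeasurableSpace Ω] (P : Measure Ω) [IsProbabilityMeasure P]
        (S : ℕ → Ω → ℤ) (ξ : ℕ → ℤ → Ω → Fin 2)
        (hS : IsSimpleRandomWalk P S) (hξ : IsCoinFamily P S r ξ),
        SolvesSEP (coinFiltration S ξ hS.measurable hξ.measurable) P S μ (coinTime S ξ)) ∧
      (∀ A B : ℤ, μ (Set.Icc A B) = 1 → 0 < μ {A} → 0 < μ {B} →
        IsGreatest (subEmbeddings μ A B) r) := by
  refine ⟨embeddingRate μ, fun Ω _ P _ S ξ hS hξ => ?_, fun A B hAB hA hB => ⟨⟨fun i hi => ?_,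
    fun i _ => ?_⟩, fun r hr => ?_⟩⟩
  · exact ⟨isStoppingTime_coinTime hS.measurable hξ.measurable, ae_coinTime_ne_top hμ hS hξ,
      hasLaw_stoppedValue hμ hS hξ, uniformIntegrable_stoppedProcess hμ hS hξ⟩
  · exact embeddingRate_eq_one_of_notMem_Ioo hμ hAB hi
  · rw [stopProb_eq, tails_mul_green_embeddingRate hμ]
  · exact le_embeddingRate hμ hAB hA hB hr.1 fun i hi => stopProb_eq r i ▸ hr.2 i hi
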